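/- Write $a\cdot b$ for the Euclidean inner product on $\mathbb R^d$. Let $(\Omega,\mathcal F,P)$ be a non-atomic probability space and let $R$ be a random non-empty compact subset of $\mathbb R^d$ (the indifference set of a consumer) that is measurable, i.e. $\{\omega : R(\omega)\cap O\neq\emptyset\}\in\mathcal F$ for every open $O\subseteq\mathbb R^d$, with $\mathbb E[\sup_{q\in R}\|q\|]<\infty$. For a random set $S$, let $\mathbb E[S]$ be the set of all $\mathbb E[X]$, where $X$ is an integrable random vector with $X\in S$ almost surely. For a set $C$ put $h(p;C)=\inf\{q\cdot p : q\in C\}$, and let $H(p)=h(p;\mathbb E[R])$. Let $\rho:\mathbb R^d\to\mathbb R$ be convex with $\rho(\alpha q)=\alpha\rho(q)$ for all $\alpha\ge 0$ and $q\in\mathbb R^d$, let $\mathcal P=\{z\in\mathbb R^d : z\cdot q\le\rho(q)\text{ for all }q\in\mathbb R^d\}$, and let $q_0\in\mathbb R^d$. Assume that for every optimal price $z^*\in\operatorname{argmax}\{H(z)-z\cdot q_0 : z\in\mathcal P\}$ the function $h(\cdot\,;R)$ is almost surely differentiable at $z^*$. Suppose furthermore that $\rho\ge 0$, that $\rho(q)=0$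 if and only if $q=0$, and that $q_0\notin\mathbb E[R]$. Then for every optimal price $z^*$ the average consumption profile $\bar q(z^*)$ is well defined, in the sense that $$\{q\in\mathbb E[R] : q\cdot z^*=H(z^*)\}=\mathbb E\big[\{q\in R : q\cdot z^*=h(z^*;R)\}\big]=\{\bar q(z^*)\},$$ and the per-consumer revenue is strictly positive: $$U(z^*)=(\bar q(z^*)-q_0)\cdot z^*>0.$$ Hence prices can be rescaled to hit any positive target revenue: for every $C>0$, at the prices $p^*=C\,z^*/U(z^*)$ the average consumption profile is again well defined in the above sense, with $\bar q(p^*)=\bar q(z^*)$, and $U(p^*)=(\bar q(p^*)-q_0)\cdot p^*=C$. -/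

import Mathlib

open MeasureTheory TopologicalSpace
open scoped InnerProductSpace

noncomputable section

namespace DemandResponse

/-- A measure is non-atomic if every measurable set of positive measure contains a measurable
subset of strictly smaller positive measure. -/
def IsNonatomic {Ω : Type*} [MeasurableSpace Ω] (μ : Measure Ω) : Prop :=
  ∀ A : Set Ω, MeasurableSet A → 0 < μ A →
    ∃ B : Set Ω, B ⊆ A ∧ MeasurableSet B ∧ 0 < μ B ∧ μ B < μ A

/-- Measurability of a compact-valued multifunction `R`: for every open `O`, the set of all `ω`
with `R ω ∩ O ≠ ∅` is measurable. -/
def IsMeasurableMultifunction {Ω : Type*} [MeasurableSpace Ω] {d : ℕ}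
    (R : Ω → NonemptyCompacts (EuclideanSpace ℝ (Fin d))) : Prop :=
  ∀ O : Set (EuclideanSpace ℝ (Fin d)), IsOpen O →
    MeasurableSet {ω | ((R ω : Set (EuclideanSpace ℝ (Fin d))) ∩ O).Nonempty}

/-- The norm `‖C‖ = sup {‖q‖ : q ∈ C}` of a set. -/
def setNorm {d : ℕ} (C : Set (EuclideanSpace ℝ (Fin d))) : ℝ :=
  sSup ((fun q => ‖q‖) '' C)

/-- `X` is a selection of the random set `S`: an integrable random vector that lies in `S` with
probability one. -/
def IsSelection {Ω : Type*} [MeasurableSpace Ω] {d : ℕ} (μ : Measure Ω)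
    (S : Ω → Set (EuclideanSpace ℝ (Fin d))) (X : Ω → EuclideanSpace ℝ (Fin d)) : Prop :=
  Integrable X μ ∧ ∀ᵐ ω ∂μ, X ω ∈ S ω

/-- The expectation of a random set: the set of the expectations of all its selections. -/
def setExpectation {Ω : Type*} [MeasurableSpace Ω] {d : ℕ} (μ : Measure Ω)
    (S : Ω → Set (EuclideanSpace ℝ (Fin d))) : Set (EuclideanSpace ℝ (Fin d)) :=
  {q | ∃ X : Ω → EuclideanSpace ℝ (Fin d), IsSelection μ S X ∧ q = ∫ ω, X ω ∂μ}

/-- The cost `h(p; C) = min {q · p : q ∈ C}` of consuming optimally within `C` at prices `p`. -/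
def userCost {d : ℕ} (p : EuclideanSpace ℝ (Fin d)) (C : Set (EuclideanSpace ℝ (Fin d))) : ℝ :=
  sInf ((fun q => ⟪q, p⟫_ℝ) '' C)

/-- The cost-minimizing profiles `{q ∈ C : q · p = h(p; C)}`. -/
def optimalProfiles {d : ℕ} (p : EuclideanSpace ℝ (Fin d))
    (C : Set (EuclideanSpace ℝ (Fin d))) : Set (EuclideanSpace ℝ (Fin d)) :=
  {q | q ∈ C ∧ ⟪q, p⟫_ℝ = userCost p C}

/-- The expected indifference set `E[R]`. -/
def meanSet {Ω : Type*} [MeasurableSpace Ω] {d : ℕ} (μ : Measure Ω)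
    (R : Ω → NonemptyCompacts (EuclideanSpace ℝ (Fin d))) : Set (EuclideanSpace ℝ (Fin d)) :=
  setExpectation μ (fun ω => (R ω : Set (EuclideanSpace ℝ (Fin d))))

/-- The mean-field user cost `H(p) = h(p; E[R])`. -/
def meanCost {Ω : Type*} [MeasurableSpace Ω] {d : ℕ} (μ : Measure Ω)
    (R : Ω → NonemptyCompacts (EuclideanSpace ℝ (Fin d))) (p : EuclideanSpace ℝ (Fin d)) : ℝ :=
  userCost p (meanSet μ R)

/-- The set `𝒫 = {z : z · q ≤ ρ(q) for all q}`. -/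
def priceSet {d : ℕ} (ρ : EuclideanSpace ℝ (Fin d) → ℝ) : Set (EuclideanSpace ℝ (Fin d)) :=
  {z | ∀ q, ⟪z, q⟫_ℝ ≤ ρ q}

/-- The optimal prices `argmax {H(z) - z · q₀ : z ∈ 𝒫}`. -/
def optimalPrices {Ω : Type*} [MeasurableSpace Ω] {d : ℕ} (μ : Measure Ω)
    (R : Ω → NonemptyCompacts (EuclideanSpace ℝ (Fin d))) (ρ : EuclideanSpace ℝ (Fin d) → ℝ)
    (q₀ : EuclideanSpace ℝ (Fin d)) : Set (EuclideanSpace ℝ (Fin d)) :=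
  {z | z ∈ priceSet ρ ∧ IsMaxOn (fun w => meanCost μ R w - ⟪w, q₀⟫_ℝ) (priceSet ρ) z}

/-- `q` is the unique average consumption profile at prices `z`: it is the only element of
`Θ(z) = {q ∈ E[R] : q · z = h(z; E[R])}`, and also the only element of the expectation of the
random set of profiles that are optimal for a consumer at prices `z`. -/
def IsAverageConsumption {Ω : Type*} [MeasurableSpace Ω] {d : ℕ} (μ : Measure Ω)
    (R : Ω → NonemptyCompacts (EuclideanSpace ℝ (Fin d))) (z q : EuclideanSpace ℝ (Fin d)) : Prop :=
  optimalProfiles z (meanSet μ R) = {q} ∧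
    setExpectation μ
      (fun ω => optimalProfiles z (R ω : Set (EuclideanSpace ℝ (Fin d)))) = {q}

open Classical in
/-- The average consumption profile `q̄(z)`, that is, the element of `Θ(z)` when this set is a
singleton (and the meaningless value `0` otherwise). -/
def averageConsumption {Ω : Type*} [MeasurableSpace Ω] {d : ℕ} (μ : Measure Ω)
    (R : Ω → NonemptyCompacts (EuclideanSpace ℝ (Fin d))) (z : EuclideanSpace ℝ (Fin d)) :
    EuclideanSpace ℝ (Fin d) :=
  if hz : ∃ q, optimalProfiles z (meanSet μ R) = {q} then hz.choose else 0

/-- The per-consumer revenue `U(z) = (q̄(z) - q₀) · z`. -/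
def revenue {Ω : Type*} [MeasurableSpace Ω] {d : ℕ} (μ : Measure Ω)
    (R : Ω → NonemptyCompacts (EuclideanSpace ℝ (Fin d))) (q₀ z : EuclideanSpace ℝ (Fin d)) : ℝ :=
  ⟪averageConsumption μ R z - q₀, z⟫_ℝ

end DemandResponse

end

open DemandResponse

/-! Where `userCost` is differentiable, the optimal profile is unique: it is the gradient. At an
optimal price `z` the cheapest selection of `R` is thus a.s. unique, and its mean is the only
element of both sets in `IsAverageConsumption` (`isAverageConsumption_integral`). The revenue at `z`
is then the maximal value of the objective. Were it non-positive, `0` would be optimal too; every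
profile is optimal at price `0`, so `E[R]` would be a single point `x ≠ q₀`, and a small multiple of
`x - q₀` would be a feasible price with positive objective (`revenue_pos`). Positive rescaling keeps
the minimizers and scales the revenue. -/

namespace DemandResponse

variable {Ω : Type*} [MeasurableSpace Ω] {d : ℕ}

section Compact

variable {C : Set (EuclideanSpace ℝ (Fin d))}

lemma norm_le_setNorm (hC : IsCompact C) {q : EuclideanSpace ℝ (Fin d)} (hq : q ∈ C) :
    ‖q‖ ≤ setNorm C :=
  le_csSup (hC.image continuous_norm).bddAbove ⟨q, hq, rfl⟩

lemma userCost_le (hC : IsCompact C) (p : EuclideanSpace ℝ (Fin d))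
    {q : EuclideanSpace ℝ (Fin d)} (hq : q ∈ C) : userCost p C ≤ ⟪q, p⟫_ℝ :=
  csInf_le (hC.image (by fun_prop : Continuous fun q => ⟪q, p⟫_ℝ)).bddBelow ⟨q, hq, rfl⟩

lemma optimalProfiles_nonempty (hC : IsCompact C) (hne : C.Nonempty)
    (p : EuclideanSpace ℝ (Fin d)) : (optimalProfiles p C).Nonempty := by
  obtain ⟨q, hq, h⟩ := (hC.image (by fun_prop : Continuous fun q => ⟪q, p⟫_ℝ)).sInf_mem
    (hne.image _)
  exact ⟨q, hq, h⟩

lemma userCost_lt_iff (hC : IsCompact C) (hne : C.Nonempty) (p : EuclideanSpace ℝ (Fin d))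
    (c : ℝ) : userCost p C < c ↔ (C ∩ {q | ⟪q, p⟫_ℝ < c}).Nonempty := by
  constructor
  · intro h
    obtain ⟨q, hq, hqp⟩ := optimalProfiles_nonempty hC hne p
    exact ⟨q, hq, by simpa [hqp] using h⟩
  · rintro ⟨q, hq, hqc⟩
    exact (userCost_le hC p hq).trans_lt hqc

/-- Where the user cost is differentiable, its derivative is the inner product with any optimal
profile. -/
lemma fderiv_userCost_apply (hC : IsCompact C) {z q : EuclideanSpace ℝ (Fin d)}
    (hd : DifferentiableAt ℝ (fun p => userCost p C) z) (hq : q ∈ optimalProfiles z C)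
    (v : EuclideanSpace ℝ (Fin d)) : fderiv ℝ (fun p => userCost p C) z v = ⟪q, v⟫_ℝ := by
  -- This function of `p` is nonnegative and vanishes at `z`, so its derivative there is zero.
  have hmin : IsLocalMin (fun p => innerSL ℝ q p - userCost p C) z := by
    refine Filter.Eventually.of_forall fun p => ?_
    simpa [hq.2] using userCost_le hC p hq.1
  have h := hmin.hasFDerivAt_eq_zero ((innerSL ℝ q).hasFDerivAt.sub hd.hasFDerivAt)
  have hv := congrArg (fun L => L v) h
  simp only [sub_apply, innerSL_apply_apply,
    zero_apply] at hv
  linarith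

lemma optimalProfiles_subsingleton (hC : IsCompact C) {z : EuclideanSpace ℝ (Fin d)}
    (hd : DifferentiableAt ℝ (fun p => userCost p C) z) : (optimalProfiles z C).Subsingleton := by
  intro q hq q' hq'
  refine ext_inner_right ℝ fun v => ?_
  rw [← fderiv_userCost_apply hC hd hq, fderiv_userCost_apply hC hd hq']

end Compact

section Scaling

lemma userCost_smul {α : ℝ} (hα : 0 ≤ α) (z : EuclideanSpace ℝ (Fin d))
    (C : Set (EuclideanSpace ℝ (Fin d))) : userCost (α • z) C = α * userCost z C := by
  rw [userCost, userCost, ← smul_eq_mul, ← Real.sInf_smul_of_nonneg hα, ← Set.image_smul,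
    Set.image_image]
  simp [inner_smul_right]

lemma optimalProfiles_smul {α : ℝ} (hα : 0 < α) (z : EuclideanSpace ℝ (Fin d))
    (C : Set (EuclideanSpace ℝ (Fin d))) : optimalProfiles (α • z) C = optimalProfiles z C := by
  ext q
  simp [optimalProfiles, userCost_smul hα.le, inner_smul_right, hα.ne']

lemma userCost_zero (C : Set (EuclideanSpace ℝ (Fin d))) : userCost 0 C = 0 := by
  simpa using userCost_smul le_rfl (0 : EuclideanSpace ℝ (Fin d)) C

lemma optimalProfiles_zero (C : Set (EuclideanSpace ℝ (Fin d))) : optimalProfiles 0 C = C := by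
  simp [optimalProfiles, userCost_zero]

end Scaling

section PriceSet

variable {ρ : EuclideanSpace ℝ (Fin d) → ℝ}

lemma exists_pos_mul_norm_le (hconv : ConvexOn ℝ Set.univ ρ)
    (hhom : ∀ (α : ℝ) (q : EuclideanSpace ℝ (Fin d)), 0 ≤ α → ρ (α • q) = α * ρ q)
    (hpos : ∀ q, q ≠ 0 → 0 < ρ q) : ∃ c : ℝ, 0 < c ∧ ∀ q, c * ‖q‖ ≤ ρ q := by
  have h0 : ρ 0 = 0 := by simpa using hhom 0 0 le_rfl
  have hcont : Continuous ρ := continuousOn_univ.1 (hconv.continuousOn isOpen_univ)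
  rcases (Metric.sphere (0 : EuclideanSpace ℝ (Fin d)) 1).eq_empty_or_nonempty with he | hne
  -- The sphere is empty only in dimension `0`, where any constant works.
  · refine ⟨1, one_pos, fun q => ?_⟩
    have hq : q = 0 := by
      by_contra hq
      have : ‖q‖⁻¹ • q ∈ Metric.sphere (0 : EuclideanSpace ℝ (Fin d)) 1 := by
        simp [norm_smul, hq]
      simp [he] at this
    simp [hq, h0]
  · obtain ⟨u, hu, hmin⟩ := (isCompact_sphere _ _).exists_isMinOn hne hcont.continuousOn
    have hu0 : u ≠ 0 := by
      rintro rfl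
      simp at hu
    refine ⟨ρ u, hpos u hu0, fun q => ?_⟩
    rcases eq_or_ne q 0 with rfl | hq
    · simp [h0]
    have hn : 0 < ‖q‖ := norm_pos_iff.2 hq
    have h1 : ρ u ≤ ρ (‖q‖⁻¹ • q) := hmin (by simp [norm_smul, hq])
    rw [hhom _ _ (inv_nonneg.2 hn.le), inv_mul_eq_div] at h1
    exact (le_div_iff₀ hn).1 h1

/-- By Cauchy–Schwarz, `priceSet ρ` contains a ball around `0`. -/
lemma exists_pos_smul_mem_priceSet (hconv : ConvexOn ℝ Set.univ ρ)
    (hhom : ∀ (α : ℝ) (q : EuclideanSpace ℝ (Fin d)), 0 ≤ α → ρ (α • q) = α * ρ q)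
    (hpos : ∀ q, q ≠ 0 → 0 < ρ q) (y : EuclideanSpace ℝ (Fin d)) :
    ∃ t : ℝ, 0 < t ∧ t • y ∈ priceSet ρ := by
  obtain ⟨c, hc, hle⟩ := exists_pos_mul_norm_le hconv hhom hpos
  have hy : 0 < ‖y‖ + 1 := by positivity
  refine ⟨c / (‖y‖ + 1), div_pos hc hy, fun q => le_trans ?_ (hle q)⟩
  calc ⟪(c / (‖y‖ + 1)) • y, q⟫_ℝ ≤ ‖(c / (‖y‖ + 1)) • y‖ * ‖q‖ := real_inner_le_norm _ _
    _ ≤ c * ‖q‖ := by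
      gcongr
      rw [norm_smul, Real.norm_of_nonneg (div_pos hc hy).le, div_mul_eq_mul_div,
        div_le_iff₀ hy]
      nlinarith

end PriceSet

section RandomSet

variable {μ : Measure Ω} {R : Ω → NonemptyCompacts (EuclideanSpace ℝ (Fin d))}

lemma measurable_userCost (hR : IsMeasurableMultifunction R) (p : EuclideanSpace ℝ (Fin d)) :
    Measurable fun ω => userCost p (R ω : Set (EuclideanSpace ℝ (Fin d))) := by
  refine measurable_of_Iio fun c => ?_
  have : (fun ω => userCost p (R ω : Set (EuclideanSpace ℝ (Fin d)))) ⁻¹' Set.Iio c =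
      {ω | ((R ω : Set (EuclideanSpace ℝ (Fin d))) ∩ {q | ⟪q, p⟫_ℝ < c}).Nonempty} := by
    ext ω
    exact userCost_lt_iff (R ω).isCompact (R ω).nonempty p c
  rw [this]
  exact hR _ (isOpen_lt (by fun_prop) continuous_const)

/-- A pointwise choice of optimal profiles is measurable up to a null set, provided that the user
cost is almost surely differentiable. -/
lemma aemeasurable_of_mem_optimalProfiles (hR : IsMeasurableMultifunction R)
    {z : EuclideanSpace ℝ (Fin d)}
    (hd : ∀ᵐ ω ∂μ,
      DifferentiableAt ℝ (fun p => userCost p (R ω : Set (EuclideanSpace ℝ (Fin d)))) z)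
    {X : Ω → EuclideanSpace ℝ (Fin d)}
    (hX : ∀ ω, X ω ∈ optimalProfiles z (R ω : Set (EuclideanSpace ℝ (Fin d)))) :
    AEMeasurable X μ := by
  have hcoord : ∀ i, AEMeasurable (fun ω => X ω i) μ := by
    intro i
    set v : EuclideanSpace ℝ (Fin d) := EuclideanSpace.single i 1
    -- The `i`-th coordinate of `X` is a.s. the derivative of the user cost along `v`, a limit of
    -- measurable difference quotients.
    refine aemeasurable_of_tendsto_metrizable_ae Filter.atTop
      (f := fun (n : ℕ) ω => (n : ℝ) •
        (userCost (z + (n : ℝ)⁻¹ • v) (R ω : Set (EuclideanSpace ℝ (Fin d))) -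
          userCost z (R ω : Set (EuclideanSpace ℝ (Fin d)))))
      (fun n => (((measurable_userCost hR _).sub (measurable_userCost hR _)).const_smul
        (n : ℝ)).aemeasurable) ?_
    filter_upwards [hd] with ω hω
    have h := hω.hasFDerivAt.lim v
      (tendsto_norm_atTop_atTop.comp tendsto_natCast_atTop_atTop)
    rw [fderiv_userCost_apply (R ω).isCompact hω (hX ω)] at h
    simpa [v, EuclideanSpace.inner_single_right] using h
  have : X = fun ω => (WithLp.toLp 2 fun i => X ω i) := rfl
  rw [this]
  exact (WithLp.measurable_toLp 2 _).comp_aemeasurable (aemeasurable_pi_lambda _ hcoord)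

lemma isAverageConsumption_integral (hR : IsMeasurableMultifunction R)
    (hRint : Integrable (fun ω => setNorm (R ω : Set (EuclideanSpace ℝ (Fin d)))) μ)
    {z : EuclideanSpace ℝ (Fin d)}
    (hd : ∀ᵐ ω ∂μ,
      DifferentiableAt ℝ (fun p => userCost p (R ω : Set (EuclideanSpace ℝ (Fin d)))) z)
    {X : Ω → EuclideanSpace ℝ (Fin d)}
    (hX : ∀ ω, X ω ∈ optimalProfiles z (R ω : Set (EuclideanSpace ℝ (Fin d)))) :
    IsAverageConsumption μ R z (∫ ω, X ω ∂μ) := by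
  have hXint : Integrable X μ :=
    hRint.mono' (aemeasurable_of_mem_optimalProfiles hR hd hX).aestronglyMeasurable
      (.of_forall fun ω => norm_le_setNorm (R ω).isCompact (hX ω).1)
  have huniq : ∀ Y : Ω → EuclideanSpace ℝ (Fin d),
      (∀ᵐ ω ∂μ, Y ω ∈ optimalProfiles z (R ω : Set (EuclideanSpace ℝ (Fin d)))) →
        Y =ᵐ[μ] X := by
    intro Y hY
    filter_upwards [hd, hY] with ω hω hYω
    exact optimalProfiles_subsingleton (R ω).isCompact hω hYω (hX ω)
  have hmem : ∫ ω, X ω ∂μ ∈ meanSet μ R := ⟨X, ⟨hXint, .of_forall fun ω => (hX ω).1⟩, rfl⟩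
  have hinner : ∀ Y : Ω → EuclideanSpace ℝ (Fin d), Integrable Y μ →
      ⟪∫ ω, Y ω ∂μ, z⟫_ℝ = ∫ ω, ⟪Y ω, z⟫_ℝ ∂μ := fun Y hY => by
    simp_rw [real_inner_comm z]
    exact (integral_inner hY z).symm
  have hle : ∀ Y : Ω → EuclideanSpace ℝ (Fin d),
      IsSelection μ (fun ω => (R ω : Set (EuclideanSpace ℝ (Fin d)))) Y →
        ∀ᵐ ω ∂μ, ⟪X ω, z⟫_ℝ ≤ ⟪Y ω, z⟫_ℝ := fun Y hY => by
    filter_upwards [hY.2] with ω hω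
    rw [(hX ω).2]
    exact userCost_le (R ω).isCompact z hω
  have hcost : userCost z (meanSet μ R) = ⟪∫ ω, X ω ∂μ, z⟫_ℝ := by
    refine IsLeast.csInf_eq ⟨⟨_, hmem, rfl⟩, ?_⟩
    rintro _ ⟨_, ⟨Y, hY, rfl⟩, rfl⟩
    simp only [hinner X hXint, hinner Y hY.1]
    exact integral_mono_ae (hXint.inner_const z) (hY.1.inner_const z) (hle Y hY)
  refine ⟨Set.eq_singleton_iff_unique_mem.2 ⟨⟨hmem, hcost.symm⟩, ?_⟩,
    Set.eq_singleton_iff_unique_mem.2 ⟨⟨X, ⟨hXint, .of_forall hX⟩, rfl⟩, ?_⟩⟩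
  · rintro _ ⟨⟨Y, hY, rfl⟩, hYcost⟩
    -- Since `X` is a.s. cheapest, equal expected costs force a.s. equal costs, so `Y` is a.s.
    -- optimal.
    rw [hcost, hinner X hXint, hinner Y hY.1, eq_comm,
      integral_eq_iff_of_ae_le (hXint.inner_const z) (hY.1.inner_const z) (hle Y hY)] at hYcost
    refine integral_congr_ae (huniq Y ?_)
    filter_upwards [hYcost, hY.2] with ω h1 h2
    exact ⟨h2, h1.symm.trans (hX ω).2⟩
  · rintro _ ⟨Y, hY, rfl⟩
    exact integral_congr_ae (huniq Y hY.2)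

lemma IsAverageConsumption.averageConsumption_eq {z q : EuclideanSpace ℝ (Fin d)}
    (h : IsAverageConsumption μ R z q) : averageConsumption μ R z = q := by
  have hz : ∃ q, optimalProfiles z (meanSet μ R) = {q} := ⟨q, h.1⟩
  rw [averageConsumption, dif_pos hz]
  exact (Set.singleton_eq_singleton_iff.1 (h.1.symm.trans hz.choose_spec)).symm

lemma isAverageConsumption_averageConsumption (hR : IsMeasurableMultifunction R)
    (hRint : Integrable (fun ω => setNorm (R ω : Set (EuclideanSpace ℝ (Fin d)))) μ)
    {z : EuclideanSpace ℝ (Fin d)}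
    (hd : ∀ᵐ ω ∂μ,
      DifferentiableAt ℝ (fun p => userCost p (R ω : Set (EuclideanSpace ℝ (Fin d)))) z) :
    IsAverageConsumption μ R z (averageConsumption μ R z) := by
  -- The choice is arbitrary; differentiability makes it a.e. measurable.
  choose X hX using fun ω => optimalProfiles_nonempty (R ω).isCompact (R ω).nonempty z
  have h := isAverageConsumption_integral hR hRint hd hX
  rwa [h.averageConsumption_eq]

lemma IsAverageConsumption.smul {z q : EuclideanSpace ℝ (Fin d)}
    (h : IsAverageConsumption μ R z q) {α : ℝ} (hα : 0 < α) :
    IsAverageConsumption μ R (α • z) q := by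
  simpa only [IsAverageConsumption, optimalProfiles_smul hα] using h

lemma IsAverageConsumption.revenue_eq {z q : EuclideanSpace ℝ (Fin d)}
    (h : IsAverageConsumption μ R z q) (q₀ : EuclideanSpace ℝ (Fin d)) :
    revenue μ R q₀ z = meanCost μ R z - ⟪z, q₀⟫_ℝ := by
  have hq : q ∈ optimalProfiles z (meanSet μ R) := by rw [h.1]; rfl
  rw [revenue, h.averageConsumption_eq, inner_sub_left, hq.2, real_inner_comm z q₀, meanCost]

/-- If an optimal price had non-positive revenue, then zero would be an optimal price, and the
indifference sets would almost surely be singletons with mean `q₀`. -/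
lemma revenue_pos (hR : IsMeasurableMultifunction R)
    (hRint : Integrable (fun ω => setNorm (R ω : Set (EuclideanSpace ℝ (Fin d)))) μ)
    {ρ : EuclideanSpace ℝ (Fin d) → ℝ} (hconv : ConvexOn ℝ Set.univ ρ)
    (hhom : ∀ (α : ℝ) (q : EuclideanSpace ℝ (Fin d)), 0 ≤ α → ρ (α • q) = α * ρ q)
    (hnonneg : ∀ q, 0 ≤ ρ q) (hzero : ∀ q, ρ q = 0 ↔ q = 0)
    {q₀ : EuclideanSpace ℝ (Fin d)} (hq₀ : q₀ ∉ meanSet μ R)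
    (hd : ∀ z ∈ optimalPrices μ R ρ q₀, ∀ᵐ ω ∂μ,
      DifferentiableAt ℝ (fun p => userCost p (R ω : Set (EuclideanSpace ℝ (Fin d)))) z)
    {z : EuclideanSpace ℝ (Fin d)} (hz : z ∈ optimalPrices μ R ρ q₀) :
    0 < revenue μ R q₀ z := by
  by_contra! hle
  rw [(isAverageConsumption_averageConsumption hR hRint (hd z hz)).revenue_eq] at hle
  have hbound : ∀ w ∈ priceSet ρ, meanCost μ R w - ⟪w, q₀⟫_ℝ ≤ 0 :=
    fun w hw => (hz.2 hw).trans hle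
  have h0 : (0 : EuclideanSpace ℝ (Fin d)) ∈ optimalPrices μ R ρ q₀ := by
    refine ⟨fun q => by simpa using hnonneg q, fun w hw => ?_⟩
    simpa [meanCost, userCost_zero] using hbound w hw
  have hx := (isAverageConsumption_averageConsumption hR hRint (hd 0 h0)).1
  set x := averageConsumption μ R 0
  rw [optimalProfiles_zero] at hx
  -- The objective at `t • (x - q₀)` is `t * ‖x - q₀‖ ^ 2`, so the bound forces `x = q₀`.
  obtain ⟨t, ht, hmem⟩ := exists_pos_smul_mem_priceSet hconv hhom
    (fun q hq => (hnonneg q).lt_of_ne' (mt (hzero q).1 hq)) (x - q₀)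
  have h := hbound _ hmem
  have hcost : meanCost μ R (t • (x - q₀)) = ⟪t • (x - q₀), x⟫_ℝ := by
    rw [meanCost, hx, userCost, Set.image_singleton, csInf_singleton, real_inner_comm]
  rw [hcost, ← inner_sub_right, real_inner_smul_left, real_inner_self_eq_norm_sq] at h
  have hn : x - q₀ = 0 := by
    by_contra hne
    have := norm_pos_iff.2 hne
    exact absurd h (not_le.2 (by positivity))
  exact hq₀ (by rw [hx, sub_eq_zero.1 hn]; rfl)

end RandomSet

end DemandResponse

theorem mainTheorem6 {Ω : Type*} [MeasurableSpace Ω] (μ : Measure Ω) [IsProbabilityMeasure μ]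
    (hμ : IsNonatomic μ) {d : ℕ}
    (R : Ω → NonemptyCompacts (EuclideanSpace ℝ (Fin d)))
    (hR : IsMeasurableMultifunction R)
    (hRint : Integrable (fun ω => setNorm (R ω : Set (EuclideanSpace ℝ (Fin d)))) μ)
    (ρ : EuclideanSpace ℝ (Fin d) → ℝ)
    (hρconv : ConvexOn ℝ Set.univ ρ)
    (hρhom : ∀ (α : ℝ) (q : EuclideanSpace ℝ (Fin d)), 0 ≤ α → ρ (α • q) = α * ρ q)
    (q₀ : EuclideanSpace ℝ (Fin d))
    (hdiff : ∀ z ∈ optimalPrices μ R ρ q₀, ∀ᵐ ω ∂μ,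
      DifferentiableAt ℝ (fun p => userCost p (R ω : Set (EuclideanSpace ℝ (Fin d)))) z)
    (hρnonneg : ∀ q, 0 ≤ ρ q)
    (hρzero : ∀ q, ρ q = 0 ↔ q = 0)
    (hq₀ : q₀ ∉ meanSet μ R) :
    ∀ z ∈ optimalPrices μ R ρ q₀,
      IsAverageConsumption μ R z (averageConsumption μ R z) ∧
      0 < revenue μ R q₀ z ∧
      ∀ C : ℝ, 0 < C →
        IsAverageConsumption μ R ((C / revenue μ R q₀ z) • z) (averageConsumption μ R z) ∧
        revenue μ R q₀ ((C / revenue μ R q₀ z) • z) = C := by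
  intro z hz
  have hav := isAverageConsumption_averageConsumption hR hRint (hdiff z hz)
  have hpos := revenue_pos hR hRint hρconv hρhom hρnonneg hρzero hq₀ hdiff hz
  refine ⟨hav, hpos, fun C hC => ?_⟩
  have hp := hav.smul (div_pos hC hpos)
  refine ⟨hp, ?_⟩
  rw [revenue, hp.averageConsumption_eq, real_inner_smul_right]
  exact div_mul_cancel₀ C hpos.ne'
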